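/- Let $\mathcal A$ (students), $\mathcal I$ (schools) and $\mathcal T$ (traits) be finite sets and let the set of contracts be $\mathcal X=\mathcal A\times\mathcal I$; for $x=(a,i)$ write $\alpha(x)=a$, and write $\mathcal X_i=\mathcal A\times\{i\}$. Each school $i$ has a priority order $\succ_i$ (a linear order) on $\mathcal X_i$, a capacity $q_i\in\mathbb N=\{0,1,2,\dots\}$, a set $\mathcal X_i^{ge}\subseteq\mathcal X_i$ of contracts with its returning students, $|\mathcal X_i^{ge}|\le q_i$, and numbers $r_i^t\in\mathbb N$ ($t\in\mathcal T$) of seats reserved for trait $t$. Each student $a$ has a set of traits $\tau(a)\subseteq\mathcal T$. For $Y\subseteq\mathcal X_i$ let $r_i(Y)$ be the rank of $Y$ in the transversal matroid of school $i$, that is, the largest number of students with contracts in $Y$ that can be assigned to distinct reserved seats of $i$, each student to a seat reserved for one of the student's traits. A problem $R=(R_a)_{a\in\mathcal A}$ consists of a linear order $R_a$ on $\mathcal X_a\cup\{\emptyset\}$ for each student $a$, where $\mathcal X_a=\{a\}\times\mathcal I$ and $\emptyset$ is the null contract; $P_a$ is the strict part of $R_a$. A matching is a set $X\subseteq\mathcal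 X$ that contains at most one contract of each student; $X_i=X\cap\mathcal X_i$, and $X_a$ is the contract of $a$ in $X$, or $\emptyset$. A matching rule $\varphi$ assigns a matching $\varphi(R)$ to each problem $R$, and $\varphi$ satisfies a property of matchings if $\varphi(R)$ satisfies it at $R$ for every problem $R$. Consider the following properties of a matching $X$ at $R$. * Guaranteed enrollment for returning students: for all $i$ and $x\in\mathcal X_i^{ge}\setminus X_i$, $X_{\alpha(x)}\mathrel{P_{\alpha(x)}}x$. * Maximal utilization of reservations: for all $i$ and $x\in\mathcal X_i\setminus X_i$ with $x\mathrel{P_{\alpha(x)}}X_{\alpha(x)}$, if $|X_i|<q_i$ then $r_i(X_i\cup\{x\})=r_i(X_i)$, and if $|X_i|=q_i$ then $r_i((X_i\setminus\{y\})\cup\{x\})\le r_i(X_i)$ for every $y\in X_i\setminus\mathcal X_i^{ge}$. * No justified envy under reserves: for all $i$, all $x\in\mathcal X_i\setminus X_i$ with $x\mathrel{P_{\alpha(x)}}X_{\alpha(x)}$ and all $y\in X_i\setminus\mathcal X_i^{ge}$, if $x\succ_i y$ then $r_i((X_i\setminus\{y\})\cup\{x\})<r_i(X_i)$. * Non-wastefulness: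 for all $i$, $|X_i|\le q_i$, and $|X_i|=q_i$ whenever some $x\in\mathcal X_i$ has $x\mathrel{P_{\alpha(x)}}X_{\alpha(x)}$. * Individual rationality: $X_a\mathrel{R_a}\emptyset$ for all $a$. The rule $\varphi$ is strategy-proof if $\varphi(R)_a\mathrel{R_a}\varphi(R'_a,R_{-a})_a$ for every problem $R$, every student $a$ and every alternative preference $R'_a$ of $a$. The guaranteed-enrollment choice rule $C_i^{ge}$ chooses from each $Y\subseteq\mathcal X_i$ as follows. (1) Choose all contracts in $Y\cap\mathcal X_i^{ge}$. (2) As long as fewer than $q_i$ contracts are chosen and some unchosen contract in $Y$ increases the rank $r_i$ of the set chosen so far, add the $\succ_i$-highest such contract. (3) Then add the remaining contracts of $Y$ in order of priority until $q_i$ contracts, or all of $Y$, are chosen. The deferred-acceptance (DA) rule based on choice rules $(C_i)_{i\in\mathcal I}$ is computed as follows: at each step, each student whose contract is not tentatively accepted proposes the most preferred acceptable contract that has not been rejected so far (or is assigned $\emptyset$ if there is none); each school $i$ tentatively accepts $C_i(Y)$ and permanently rejects $Y\setminus C_i(Y)$, where $Y$ consists of its tentatively accepted contracts and the new proposals to it.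 The algorithm stops at the first step without a rejection and returns the accepted contracts. Then a matching rule satisfies guaranteed enrollment for returning students, maximal utilization of reservations, no justified envy under reserves, non-wastefulness, individual rationality and strategy-proofness if and only if it is the DA rule based on $C^{ge}=(C_i^{ge})_{i\in\mathcal I}$. -/

import Mathlib

open scoped Classical

noncomputable section

namespace SchoolChoice

/-- A linear order on `S`, read as a ranking: `p.rel x y` says that `x` is ranked weakly above
`y`. -/
structure Ranking (S : Type*) where
  rel : S → S → Prop
  antisymm : ∀ x y, rel x y → rel y x → x = y
  trans : ∀ x y z, rel x y → rel y z → rel x z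
  total : ∀ x y, rel x y ∨ rel y x

/-- `x` is ranked strictly above `y`. -/
def Ranking.strict {S : Type*} (p : Ranking S) (x y : S) : Prop :=
  p.rel x y ∧ x ≠ y

theorem Ranking.exists_best {S : Type*} (p : Ranking S) (X : Finset S) (hX : X.Nonempty) :
    ∃ x ∈ X, ∀ y ∈ X, p.rel x y := by
  induction hX using Finset.Nonempty.cons_induction with
  | singleton a => exact ⟨a, by simp, by simpa using p.total a a⟩
  | cons a s _ _ ih =>
    obtain ⟨b, hb, hbs⟩ := ih
    have haa : p.rel a a := by simpa using p.total a a
    rcases p.total a b with h | h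
    · refine ⟨a, by simp, fun y hy => ?_⟩
      rcases Finset.mem_cons.1 hy with rfl | hy
      · exact haa
      · exact p.trans _ _ _ h (hbs y hy)
    · refine ⟨b, by simp [hb], fun y hy => ?_⟩
      rcases Finset.mem_cons.1 hy with rfl | hy
      · exact h
      · exact hbs y hy

/-- The highest ranked element of a nonempty finite set. -/
def Ranking.best {S : Type*} (p : Ranking S) (X : Finset S) (hX : X.Nonempty) : S :=
  (p.exists_best X hX).choose

theorem Ranking.best_mem {S : Type*} (p : Ranking S) (X : Finset S) (hX : X.Nonempty) :
    p.best X hX ∈ X :=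
  (p.exists_best X hX).choose_spec.1

theorem Ranking.best_rel {S : Type*} (p : Ranking S) (X : Finset S) (hX : X.Nonempty) :
    ∀ y ∈ X, p.rel (p.best X hX) y :=
  (p.exists_best X hX).choose_spec.2

/-! ### Problems, matchings, choice rules

The contracts are the pairs of a student `a : A` and a school `i : I`.  The contracts of a fixed
student `a` are identified with the schools, and the contracts of a fixed school `i` with the
students. -/

/-- A matching problem: every student ranks the schools and the null contract `none`. -/
abbrev Problem (A I : Type*) := A → Ranking (Option I)

/-- A matching: a set of student-school pairs with at most one pair for each student, given by
the assignment of each student (`none` when the student has no pair in the set). -/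
abbrev Matching (A I : Type*) := A → Option I

/-- The set of students matched with school `i`. -/
def Matching.at {A I : Type*} [Fintype A] (μ : Matching A I) (i : I) : Finset A :=
  Finset.univ.filter fun a => μ a = some i

/-- A choice rule of a school: it selects a subset of any given set of applicants. -/
structure ChoiceRule (A : Type*) where
  choice : Finset A → Finset A
  subset : ∀ X, choice X ⊆ X

/-! ### The deferred-acceptance rule

Tentatively accepted contracts are proposed again at the next step: a contract that is held by a
school is still the most preferred one of its student among those not rejected so far. -/

section DA

variable {A I : Type*} [Fintype A] [Fintype I]

/-- The proposal of student `a` when `rej` is the set of the contracts rejected so far: the most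
preferred acceptable contract outside `rej`, or `none` if there is no such contract. -/
def proposal (R : Problem A I) (rej : Finset (A × I)) (a : A) : Option I :=
  (R a).best (insert none ((Finset.univ.filter fun i => (a, i) ∉ rej).image some))
    (Finset.insert_nonempty _ _)

/-- The students considered by school `i` when `rej` is the set of contracts rejected so far. -/
def considered (R : Problem A I) (rej : Finset (A × I)) (i : I) : Finset A :=
  Matching.at (proposal R rej) i

/-- The contracts that are rejected at the step that starts with the rejected set `rej`. -/
def newRejections (C : I → ChoiceRule A) (R : Problem A I) (rej : Finset (A × I)) :
    Finset (A × I) :=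
  Finset.univ.filter fun x =>
    x.1 ∈ considered R rej x.2 \ (C x.2).choice (considered R rej x.2)

/-- The contracts rejected at the first `s` steps of the deferred-acceptance algorithm. -/
def rejected (C : I → ChoiceRule A) (R : Problem A I) : ℕ → Finset (A × I)
  | 0 => ∅
  | s + 1 => rejected C R s ∪ newRejections C R (rejected C R s)

/-- The contracts accepted at the step that starts with the rejected set `rej`. -/
def accepted (C : I → ChoiceRule A) (R : Problem A I) (rej : Finset (A × I)) : Matching A I :=
  fun a => (proposal R rej a).bind fun i =>
    if a ∈ (C i).choice (considered R rej i) then some i else none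

/-- The deferred-acceptance rule based on `C`: the acceptances at the last step.  After
`card (A × I)` steps there are no further rejections (`newRejections_rejected_card`), and from
the first step without rejections on nothing changes. -/
def deferredAcceptance (C : I → ChoiceRule A) : Problem A I → Matching A I :=
  fun R => accepted C R (rejected C R (Fintype.card (A × I)))

theorem disjoint_newRejections (C : I → ChoiceRule A) (R : Problem A I) (rej : Finset (A × I)) :
    Disjoint rej (newRejections C R rej) := by
  rw [Finset.disjoint_right]
  rintro ⟨a, i⟩ hx
  have h : proposal R rej a = some i := by
    simp only [newRejections, considered, Matching.at, Finset.mem_filter, Finset.mem_sdiff] at hx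
    exact hx.2.1.2
  have hm := (R a).best_mem
    (insert none ((Finset.univ.filter fun i => (a, i) ∉ rej).image some))
    (Finset.insert_nonempty _ _)
  change proposal R rej a ∈ _ at hm
  rw [h] at hm
  simpa using hm

theorem newRejections_rejected_card (C : I → ChoiceRule A) (R : Problem A I) :
    newRejections C R (rejected C R (Fintype.card (A × I))) = ∅ := by
  have key : ∀ s, newRejections C R (rejected C R s) = ∅ ∨ s ≤ (rejected C R s).card := by
    intro s
    induction s with
    | zero => right; simp
    | succ s ih =>
      by_cases h0 : newRejections C R (rejected C R s) = ∅
      · left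
        have : rejected C R (s + 1) = rejected C R s := by simp [rejected, h0]
        rw [this, h0]
      · right
        have h1 := ih.resolve_left h0
        have h2 := Finset.card_union_of_disjoint (disjoint_newRejections C R (rejected C R s))
        have h3 := Finset.card_pos.2 (Finset.nonempty_iff_ne_empty.2 h0)
        change s + 1 ≤ (rejected C R s ∪ newRejections C R (rejected C R s)).card
        omega
  rcases key (Fintype.card (A × I)) with h | h
  · exact h
  · have hu : rejected C R (Fintype.card (A × I)) = Finset.univ :=
      (Finset.card_eq_iff_eq_univ _).1 (le_antisymm (Finset.card_le_univ _) h)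
    have hd := disjoint_newRejections C R (rejected C R (Fintype.card (A × I)))
    rw [hu] at hd ⊢
    exact Finset.disjoint_left.1 hd |> fun h' =>
      Finset.eq_empty_of_forall_notMem fun x => h' (Finset.mem_univ x)

end DA

/-! ### The Chilean school-choice setting -/

/-- Students `A`, schools `I`, traits `T`. -/
structure Market (A I T : Type*) where
  /-- the priority order of each school over its contracts -/
  priority : I → Ranking A
  capacity : I → ℕ
  /-- the returning students of each school -/
  returning : I → Finset A
  card_returning_le : ∀ i, (returning i).card ≤ capacity i
  /-- the traits that each student has -/
  traits : A → Set T
  /-- the number of seats that each school reserves for each trait -/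
  reserve : I → T → ℕ

namespace Market

variable {A I T : Type*} (M : Market A I T)

/-- The reserved seats of school `i`: there are `reserve i t` of them for each trait `t`. -/
abbrev Seat (i : I) := Σ t : T, Fin (M.reserve i t)

/-- The independent sets of the transversal matroid of school `i`: the sets of students that can
be assigned to different reserved seats, each to a seat reserved for a trait of theirs. -/
def Indep (i : I) (X : Finset A) : Prop :=
  ∃ f : {a // a ∈ X} → M.Seat i, Function.Injective f ∧ ∀ a, (f a).1 ∈ M.traits a.1

/-- The rank function of that matroid: the largest size of an independent subset. -/
def rank (i : I) (X : Finset A) : ℕ :=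
  (X.powerset.filter fun Y => M.Indep i Y).sup Finset.card

/-- One seat of Step 2 of the guaranteed-enrollment choice rule, at the choice problem `X` when
`Y` has been chosen so far: unless the capacity is reached, the highest priority contract of `X`
that increases the reserve utilization is added, if there is one. -/
def reserveStep (i : I) (X Y : Finset A) : Finset A :=
  if h : Y.card < M.capacity i ∧
      ((X \ Y).filter fun a => M.rank i (insert a Y) = M.rank i Y + 1).Nonempty then
    insert ((M.priority i).best _ h.2) Y
  else Y

/-- One seat of Step 3: unless the capacity is reached, the highest priority contract of `X` that
is not yet chosen is added, if there is one. -/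
def fillStep (i : I) (X Y : Finset A) : Finset A :=
  if h : Y.card < M.capacity i ∧ (X \ Y).Nonempty then
    insert ((M.priority i).best _ h.2) Y
  else Y

theorem reserveStep_subset (i : I) {X Y : Finset A} (h : Y ⊆ X) : M.reserveStep i X Y ⊆ X := by
  unfold reserveStep
  split_ifs with hc
  · refine Finset.insert_subset ?_ h
    exact (Finset.mem_sdiff.1 (Finset.mem_filter.1 ((M.priority i).best_mem _ hc.2)).1).1
  · exact h

theorem fillStep_subset (i : I) {X Y : Finset A} (h : Y ⊆ X) : M.fillStep i X Y ⊆ X := by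
  unfold fillStep
  split_ifs with hc
  · refine Finset.insert_subset ?_ h
    exact (Finset.mem_sdiff.1 ((M.priority i).best_mem _ hc.2)).1
  · exact h

theorem iterate_subset {X : Finset A} {f : Finset A → Finset A}
    (hf : ∀ Y, Y ⊆ X → f Y ⊆ X) (n : ℕ) {Y : Finset A} (h : Y ⊆ X) : f^[n] Y ⊆ X := by
  induction n with
  | zero => exact h
  | succ n ih => rw [Function.iterate_succ_apply']; exact hf _ ih

/-- The guaranteed-enrollment choice rule of school `i`: first the returning students among the
applicants, then one run of `reserveStep` for each reserved seat, then `fillStep` until the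
capacity is reached or all applicants are chosen (more than `X.card` runs never change
anything). -/
def geChoice [Fintype T] (i : I) : ChoiceRule A where
  choice X := (M.fillStep i X)^[X.card]
    ((M.reserveStep i X)^[∑ t, M.reserve i t] (X ∩ M.returning i))
  subset _ := iterate_subset (fun _ => M.fillStep_subset i) _
    (iterate_subset (fun _ => M.reserveStep_subset i) _ Finset.inter_subset_left)

/-! ### The matching axioms, for a matching `μ` at a problem `R` -/

variable [Fintype A]

/-- Guaranteed enrollment for returning students. -/
def GuaranteedEnrollment (R : Problem A I) (μ : Matching A I) : Prop :=
  ∀ i, ∀ a ∈ M.returning i, a ∉ μ.at i → (R a).strict (μ a) (some i)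

/-- Maximal utilization of reservations. -/
def MaximalUtilization (R : Problem A I) (μ : Matching A I) : Prop :=
  ∀ i, ∀ a ∉ μ.at i, (R a).strict (some i) (μ a) →
    ((μ.at i).card < M.capacity i → M.rank i (μ.at i ∪ {a}) = M.rank i (μ.at i)) ∧
    ((μ.at i).card = M.capacity i →
      ∀ b ∈ μ.at i \ M.returning i, M.rank i ((μ.at i \ {b}) ∪ {a}) ≤ M.rank i (μ.at i))

/-- No justified envy under reserves. -/
def NoJustifiedEnvyUnderReserves (R : Problem A I) (μ : Matching A I) : Prop :=
  ∀ i, ∀ a ∉ μ.at i, (R a).strict (some i) (μ a) →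
    ∀ b ∈ μ.at i \ M.returning i, (M.priority i).strict a b →
      M.rank i ((μ.at i \ {b}) ∪ {a}) < M.rank i (μ.at i)

/-- Non-wastefulness. -/
def NonWasteful (R : Problem A I) (μ : Matching A I) : Prop :=
  ∀ i, (μ.at i).card ≤ M.capacity i ∧
    ∀ a, (R a).strict (some i) (μ a) → (μ.at i).card = M.capacity i

end Market

/-- Individual rationality of a matching at `R`. -/
def IndividuallyRational {A I : Type*} (R : Problem A I) (μ : Matching A I) : Prop :=
  ∀ a, (R a).rel (μ a) none

/-- Strategy-proofness of a matching rule. -/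
def StrategyProof {A I : Type*} (φ : Problem A I → Matching A I) : Prop :=
  ∀ (R : Problem A I) (a : A) (p : Ranking (Option I)),
    (R a).rel (φ R a) (φ (Function.update R a p) a)

end SchoolChoice

end

open SchoolChoice

noncomputable section

namespace SchoolChoice

/-! ### Rankings and their modifications -/

namespace Ranking

variable {S : Type*} (p : Ranking S)

/-! The demand for a school consists of the students who weakly prefer it to their match. A matching
is stable if it is individually rational and every school chooses exactly its own students from its
demand. The proof separates a matroid part, which identifies the axioms on matchings with stability,
from a part valid for all well-behaved choice rules.

Matroid part. Apart from individual rationality, the axioms say that each school's set of students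
is a choice from its demand that no exchange of one student improves (`IsLocallyOptimal`). The
greedy rule produces such a set (`FillInvariant.isLocallyOptimal`). The rank function satisfies an
exchange inequality on sets of equal size (`IsRankFunction.exists_exchange`), which forces two
locally optimal choices from nested sets of applicants to be consistent
(`IsLocallyOptimal.inter_subset`). This gives both uniqueness, hence `axioms_iff_stable`, and
substitutability; the law of aggregate demand holds because applicants are rejected only at
capacity.

Matching part. Under substitutability and the law of aggregate demand, deferred acceptance is
stable, is best for every student among stable matchings, and matches the same students as every
stable matching. Shortening one student's preference list then yields strategy-proofness, and shows
that no other stable rule is strategy-proof. -/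

theorem refl (x : S) : p.rel x x := by simpa using p.total x x

theorem rel_of_not_rel {x y : S} (h : ¬ p.rel x y) : p.rel y x := (p.total x y).resolve_left h

/-- The ranking that places the members of `U` on top and keeps the order otherwise. -/
def promote (U : Set S) : Ranking S where
  rel x y := (x ∈ U ∧ y ∉ U) ∨ ((x ∈ U ↔ y ∈ U) ∧ p.rel x y)
  antisymm x y h h' := by
    have := p.antisymm x y
    tauto
  trans x y z h h' := by
    have := p.trans x y z
    tauto
  total x y := by
    have := p.total x y
    tauto

end Ranking

/-- The preference whose acceptable schools are those of `U`, in the order of `p`. -/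
def Ranking.shortlist {I : Type*} (p : Ranking (Option I)) (U : Set (Option I)) :
    Ranking (Option I) :=
  -- For `none ∉ U`, the outer promotion lifts `U` above `none`, which the inner one put above
  -- everything else.
  (p.promote {none}).promote U

theorem Ranking.shortlist_rel_none {I : Type*} (p : Ranking (Option I)) {U : Set (Option I)}
    (hU : none ∉ U) (x : Option I) : (p.shortlist U).rel x none ↔ x = none ∨ x ∈ U := by
  have := p.refl none
  by_cases hx : x = none
  · subst hx
    simp [shortlist, promote, this]
  · simp [shortlist, promote, hU, hx]

theorem Ranking.shortlist_rel_of_mem {I : Type*} (p : Ranking (Option I)) {U : Set (Option I)}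
    (hU : none ∉ U) {x y : Option I} (hy : y ∈ U) :
    (p.shortlist U).rel x y ↔ x ∈ U ∧ p.rel x y := by
  have hy' : y ≠ none := fun h => hU (h ▸ hy)
  by_cases hx : x ∈ U
  · have hx' : x ≠ none := fun h => hU (h ▸ hx)
    simp [shortlist, promote, hy, hx, hx', hy']
  · simp [shortlist, promote, hy, hx]

/-! ### Properties of choice rules -/

/-- A student chosen from a set is chosen from each of its subsets. -/
def ChoiceRule.Substitutable {A : Type*} (c : ChoiceRule A) : Prop :=
  ∀ ⦃X Y : Finset A⦄, X ⊆ Y → c.choice Y ∩ X ⊆ c.choice X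

/-- The law of aggregate demand. -/
def ChoiceRule.SizeMonotone {A : Type*} (c : ChoiceRule A) : Prop :=
  ∀ ⦃X Y : Finset A⦄, X ⊆ Y → (c.choice X).card ≤ (c.choice Y).card

/-- Removing rejected applicants is harmless: substitutability keeps all chosen ones, and the law of
aggregate demand leaves no room for others. -/
theorem ChoiceRule.choice_eq_of_subset {A : Type*} {c : ChoiceRule A} (hs : c.Substitutable)
    (hm : c.SizeMonotone) {X Y : Finset A} (hXY : X ⊆ Y) (h : c.choice Y ⊆ X) :
    c.choice X = c.choice Y := by
  refine (Finset.eq_of_subset_of_card_le ?_ (hm hXY)).symm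
  have := hs hXY
  rwa [Finset.inter_eq_left.2 h] at this

/-! ### Proposals -/

section Proposal

variable {A I : Type*} [Fintype I]

theorem proposal_eq_none_or (R : Problem A I) (rej : Finset (A × I)) (a : A) :
    proposal R rej a = none ∨ ∃ i, (a, i) ∉ rej ∧ proposal R rej a = some i := by
  have h := (R a).best_mem
    (insert none ((Finset.univ.filter fun i => (a, i) ∉ rej).image some))
    (Finset.insert_nonempty _ _)
  change proposal R rej a ∈ _ at h
  simp only [Finset.mem_insert, Finset.mem_image, Finset.mem_filter, Finset.mem_univ,
    true_and] at h
  rcases h with h | ⟨i, hi, h⟩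
  · exact Or.inl h
  · exact Or.inr ⟨i, hi, h.symm⟩

theorem proposal_rel_none (R : Problem A I) (rej : Finset (A × I)) (a : A) :
    (R a).rel (proposal R rej a) none :=
  (R a).best_rel _ _ _ (by simp)

theorem proposal_rel_some (R : Problem A I) {rej : Finset (A × I)} {a : A} {i : I}
    (h : (a, i) ∉ rej) : (R a).rel (proposal R rej a) (some i) :=
  (R a).best_rel _ _ _ (by simp [h])

theorem proposal_anti (R : Problem A I) {rej rej' : Finset (A × I)} (h : rej ⊆ rej') (a : A) :
    (R a).rel (proposal R rej a) (proposal R rej' a) := by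
  rcases proposal_eq_none_or R rej' a with h' | ⟨i, hi, h'⟩
  · rw [h']
    exact proposal_rel_none R rej a
  · rw [h']
    exact proposal_rel_some R fun hm => hi (h hm)

end Proposal

/-! ### Stability -/

section Stability

variable {A I : Type*} [Fintype A]

@[simp] theorem Matching.mem_at {μ : Matching A I} {i : I} {a : A} :
    a ∈ μ.at i ↔ μ a = some i := by
  simp [Matching.at]

/-- The students who rank school `i` weakly above their assignments. -/
def demand (R : Problem A I) (μ : Matching A I) (i : I) : Finset A :=
  Finset.univ.filter fun a => (R a).rel (some i) (μ a)

@[simp] theorem mem_demand {R : Problem A I} {μ : Matching A I} {i : I} {a : A} :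
    a ∈ demand R μ i ↔ (R a).rel (some i) (μ a) := by
  simp [demand]

theorem at_subset_demand (R : Problem A I) (μ : Matching A I) (i : I) :
    μ.at i ⊆ demand R μ i := fun a ha => by
  rw [Matching.mem_at] at ha
  rw [mem_demand, ha]
  exact (R a).refl _

/-- Stability: individual rationality, and each school chooses its students from its demand. -/
def Stable (C : I → ChoiceRule A) (R : Problem A I) (μ : Matching A I) : Prop :=
  IndividuallyRational R μ ∧ ∀ i, (C i).choice (demand R μ i) = μ.at i

variable {C : I → ChoiceRule A}

theorem Stable.of_demand_subset (hs : ∀ i, (C i).Substitutable) (hm : ∀ i, (C i).SizeMonotone)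
    {R R' : Problem A I} {μ : Matching A I} (h : Stable C R μ) (hir : IndividuallyRational R' μ)
    (hd : ∀ i, demand R' μ i ⊆ demand R μ i) : Stable C R' μ := by
  refine ⟨hir, fun i => ?_⟩
  rw [ChoiceRule.choice_eq_of_subset (hs i) (hm i) (hd i), h.2 i]
  rw [h.2 i]
  exact at_subset_demand R' μ i

/-- A stable matching stays stable when one of its students changes the preference in such a way
that the own match stays acceptable and no school rises above it. -/
theorem Stable.update (hs : ∀ i, (C i).Substitutable) (hm : ∀ i, (C i).SizeMonotone)
    {R : Problem A I} {μ : Matching A I} {a : A} {p p' : Ranking (Option I)}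
    (h : Stable C (Function.update R a p) μ) (hir : p'.rel (μ a) none)
    (hd : ∀ i, p'.rel (some i) (μ a) → p.rel (some i) (μ a)) :
    Stable C (Function.update R a p') μ := by
  refine h.of_demand_subset hs hm (fun b => ?_) fun i b hb => ?_
  · by_cases hb : b = a
    · subst hb
      simpa using hir
    · have := h.1 b
      simpa [hb] using this
  · rw [mem_demand] at hb ⊢
    by_cases hba : b = a
    · subst hba
      simpa using hd i (by simpa using hb)
    · simpa [hba] using hb

/-! ### The deferred-acceptance algorithm and its optimality -/

variable [Fintype I]

theorem mem_considered {R : Problem A I} {rej : Finset (A × I)} {i : I} {a : A} :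
    a ∈ considered R rej i ↔ proposal R rej a = some i := Matching.mem_at

theorem mem_newRejections {R : Problem A I} {rej : Finset (A × I)} {a : A} {i : I} :
    (a, i) ∈ newRejections C R rej ↔
      a ∈ considered R rej i ∧ a ∉ (C i).choice (considered R rej i) := by
  simp [newRejections]

theorem rejected_subset_succ (R : Problem A I) (s : ℕ) :
    rejected C R s ⊆ rejected C R (s + 1) := Finset.subset_union_left

/-- A rejected contract is weakly preferred to the current proposal. -/
theorem rel_proposal_of_mem_rejected (R : Problem A I) {a : A} {i : I} (s : ℕ)
    (h : (a, i) ∈ rejected C R s) : (R a).rel (some i) (proposal R (rejected C R s) a) := by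
  induction s with
  | zero => simp [rejected] at h
  | succ s ih =>
    have hp := proposal_anti R (rejected_subset_succ (C := C) R s) a
    rcases Finset.mem_union.1 h with h | h
    · exact (R a).trans _ _ _ (ih h) hp
    · rw [mem_newRejections, mem_considered] at h
      rw [← h.1]
      exact hp

/-- This translates the state of the algorithm into a demand: proposals move only down a student's
list, past rejected contracts. -/
theorem demand_proposal (R : Problem A I) (s : ℕ) (i : I) :
    demand R (proposal R (rejected C R s)) i =
      considered R (rejected C R s) i ∪
        Finset.univ.filter fun a => (a, i) ∈ rejected C R s := by
  ext a
  simp only [mem_demand, Finset.mem_union, mem_considered, Finset.mem_filter, Finset.mem_univ,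
    true_and]
  constructor
  · intro h
    by_cases hr : (a, i) ∈ rejected C R s
    · exact Or.inr hr
    · exact Or.inl ((R a).antisymm _ _ (proposal_rel_some R hr) h)
  · rintro (h | h)
    · rw [h]
      exact (R a).refl _
    · exact rel_proposal_of_mem_rejected R s h

theorem demand_proposal_mono (R : Problem A I) (s : ℕ) (i : I) :
    demand R (proposal R (rejected C R s)) i ⊆
      demand R (proposal R (rejected C R (s + 1))) i := fun a ha => by
  rw [mem_demand] at ha ⊢
  exact (R a).trans _ _ _ ha (proposal_anti R (rejected_subset_succ R s) a)

/-- Rejections are final because demands grow from step to step, and under substitutability a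
rejected applicant is not chosen from a larger set. -/
theorem notMem_choice_of_mem_rejected (hs : ∀ i, (C i).Substitutable) (R : Problem A I)
    {a : A} {i : I} (s : ℕ) (h : (a, i) ∈ rejected C R s) :
    a ∉ (C i).choice (demand R (proposal R (rejected C R s)) i) := by
  have hanti : ∀ {X Y : Finset A}, X ⊆ Y → a ∈ X → a ∉ (C i).choice X → a ∉ (C i).choice Y :=
    fun hXY ha hX hY => hX (hs i hXY (Finset.mem_inter.2 ⟨hY, ha⟩))
  induction s with
  | zero => simp [rejected] at h
  | succ s ih =>
    have hmem : a ∈ demand R (proposal R (rejected C R s)) i := by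
      rcases Finset.mem_union.1 h with h | h
      · exact mem_demand.2 (rel_proposal_of_mem_rejected R s h)
      · exact demand_proposal (C := C) R s i ▸ Finset.mem_union_left _ (mem_newRejections.1 h).1
    refine hanti (demand_proposal_mono R s i) hmem ?_
    rcases Finset.mem_union.1 h with h | h
    · exact ih h
    · rw [mem_newRejections] at h
      refine hanti ?_ h.1 h.2
      rw [demand_proposal]
      exact Finset.subset_union_left

theorem choice_considered_of_newRejections_eq_empty {R : Problem A I} {rej : Finset (A × I)}
    (h : newRejections C R rej = ∅) (i : I) :
    (C i).choice (considered R rej i) = considered R rej i := by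
  refine Finset.Subset.antisymm ((C i).subset _) fun a ha => ?_
  by_contra hc
  have : (a, i) ∈ newRejections C R rej := mem_newRejections.2 ⟨ha, hc⟩
  simp [h] at this

theorem deferredAcceptance_eq_proposal (R : Problem A I) :
    deferredAcceptance C R = proposal R (rejected C R (Fintype.card (A × I))) := by
  funext a
  have h := choice_considered_of_newRejections_eq_empty (newRejections_rejected_card C R)
  unfold deferredAcceptance accepted
  rcases hp : proposal R (rejected C R (Fintype.card (A × I))) a with _ | i
  · rfl
  · simp only [hp, Option.bind_some, h i, mem_considered, if_true]

/-- At the end, the demand for a school is the set it holds plus the applicants it has rejected. The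
latter would not be chosen from the demand, so they can be dropped. -/
theorem stable_deferredAcceptance (hs : ∀ i, (C i).Substitutable)
    (hm : ∀ i, (C i).SizeMonotone) (R : Problem A I) : Stable C R (deferredAcceptance C R) := by
  rw [deferredAcceptance_eq_proposal]
  refine ⟨fun a => proposal_rel_none R _ a, fun i => ?_⟩
  have hd := demand_proposal (C := C) R (Fintype.card (A × I)) i
  have h := choice_considered_of_newRejections_eq_empty (newRejections_rejected_card C R) i
  rw [← ChoiceRule.choice_eq_of_subset (hs i) (hm i) (hd ▸ Finset.subset_union_left), h]
  · rfl
  · intro a ha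
    have hmem := (C i).subset _ ha
    rw [hd] at hmem
    refine (Finset.mem_union.1 hmem).resolve_right fun hr => ?_
    exact notMem_choice_of_mem_rejected hs R _ (by simpa using hr) ha

theorem Stable.ne_of_mem_rejected (hs : ∀ i, (C i).Substitutable) {R : Problem A I}
    {ν : Matching A I} (hν : Stable C R ν) {a : A} {i : I} (s : ℕ)
    (h : (a, i) ∈ rejected C R s) : ν a ≠ some i := by
  induction s generalizing a i with
  | zero => simp [rejected] at h
  | succ s ih =>
    rcases Finset.mem_union.1 h with h | h
    · exact ih h
    · rw [mem_newRejections] at h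
      -- By induction no contract of `ν` was rejected earlier, so current proposals are weakly
      -- better than `ν` and the applicants lie in the demand at `ν`. Rejecting a contract of `ν`
      -- from them would contradict substitutability.
      have hsub : considered R (rejected C R s) i ⊆ demand R ν i := fun b hb => by
        rw [mem_considered] at hb
        rw [mem_demand, ← hb]
        rcases hb' : ν b with _ | j
        · exact proposal_rel_none R _ b
        · exact proposal_rel_some R fun hr => ih hr hb'
      intro ha
      refine h.2 (hs i hsub (Finset.mem_inter.2 ⟨?_, h.1⟩))
      rw [hν.2 i, Matching.mem_at, ha]

/-- Every student weakly prefers the deferred-acceptance outcome to any stable matching. -/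
theorem Stable.deferredAcceptance_rel (hs : ∀ i, (C i).Substitutable) {R : Problem A I}
    {ν : Matching A I} (hν : Stable C R ν) (a : A) :
    (R a).rel (deferredAcceptance C R a) (ν a) := by
  rw [deferredAcceptance_eq_proposal]
  rcases h : ν a with _ | i
  · exact proposal_rel_none R _ a
  · exact proposal_rel_some R fun hr => hν.ne_of_mem_rejected hs _ hr h

/-! ### Rural hospitals, strategy-proofness and uniqueness -/

theorem Matching.card_matched (μ : Matching A I) :
    (Finset.univ.filter fun a => μ a ≠ none).card = ∑ i, (μ.at i).card := by
  rw [← Finset.card_biUnion]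
  · congr 1
    ext a
    simp [Option.ne_none_iff_exists']
  · intro i _ j _ hij
    rw [Function.onFun, Finset.disjoint_left]
    intro a ha hb
    rw [Matching.mem_at] at ha hb
    exact hij (Option.some.inj (ha.symm.trans hb))

/-- The rural hospitals theorem: deferred acceptance matches the same students as any stable
matching. -/
theorem Stable.deferredAcceptance_eq_none_iff (hs : ∀ i, (C i).Substitutable)
    (hm : ∀ i, (C i).SizeMonotone) {R : Problem A I} {ν : Matching A I} (hν : Stable C R ν)
    (a : A) : deferredAcceptance C R a = none ↔ ν a = none := by
  have hμ := stable_deferredAcceptance hs hm R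
  set μ := deferredAcceptance C R with hμdef
  have hrel : ∀ b, (R b).rel (μ b) (ν b) := fun b => hν.deferredAcceptance_rel hs b
  have hsub : (Finset.univ.filter fun b => ν b ≠ none) ⊆
      Finset.univ.filter fun b => μ b ≠ none := fun b hb => by
    simp only [Finset.mem_filter, Finset.mem_univ, true_and] at hb ⊢
    exact fun h => hb ((R b).antisymm _ _ (hν.1 b) (h ▸ hrel b))
  -- Students are better off at `μ`, so each school's demand is smaller there. Size monotonicity
  -- bounds the number matched school by school.
  have hcard : (Finset.univ.filter fun b => μ b ≠ none).card ≤
      (Finset.univ.filter fun b => ν b ≠ none).card := by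
    rw [Matching.card_matched, Matching.card_matched]
    refine Finset.sum_le_sum fun i _ => ?_
    rw [← hμ.2 i, ← hν.2 i]
    refine hm i fun b hb => ?_
    rw [mem_demand] at hb ⊢
    exact (R b).trans _ _ _ hb (hrel b)
  have := Finset.ext_iff.1 (Finset.eq_of_subset_of_card_le hsub hcard) a
  simp only [Finset.mem_filter, Finset.mem_univ, true_and] at this
  tauto

theorem Stable.eq_none_iff (hs : ∀ i, (C i).Substitutable) (hm : ∀ i, (C i).SizeMonotone)
    {R : Problem A I} {μ ν : Matching A I} (hμ : Stable C R μ) (hν : Stable C R ν) (a : A) :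
    μ a = none ↔ ν a = none :=
  (hμ.deferredAcceptance_eq_none_iff hs hm a).symm.trans
    (hν.deferredAcceptance_eq_none_iff hs hm a)

/-- Suppose a misreport yields a strictly better school `i`. Compare the shortlist `{i}` with the
shortlist `U` of schools at least as good as `i`. If deferred acceptance leaves the student
unmatched under `U`, its outcome is also stable under `{i}`, where the misreport outcome is stable
and matches the student, against the rural hospitals theorem. Otherwise its outcome is stable at the
true preferences and gives a school in `U`, against student-optimality of the truthful outcome. -/
theorem strategyProof_deferredAcceptance (hs : ∀ i, (C i).Substitutable)
    (hm : ∀ i, (C i).SizeMonotone) : StrategyProof (deferredAcceptance C) := by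
  intro R a p
  have hst := stable_deferredAcceptance hs hm
  by_contra hcon
  have hbetter := (R a).rel_of_not_rel hcon
  rcases hi : deferredAcceptance C (Function.update R a p) a with _ | i
  · rw [hi] at hcon
    exact hcon ((hst R).1 a)
  rw [hi] at hcon hbetter
  have hnone : ¬ (R a).rel none (some i) := fun h => hcon ((R a).trans _ _ _ ((hst R).1 a) h)
  set U : Set (Option I) := {x | (R a).rel x (some i)} with hU
  have hUn : none ∉ U := hnone
  have hVn : (none : Option I) ∉ ({some i} : Set (Option I)) := by simp
  have h1 : Stable C (Function.update R a ((R a).shortlist {some i}))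
      (deferredAcceptance C (Function.update R a p)) := by
    refine (hst _).update hs hm ?_ fun j hj => ?_
    · rw [hi, Ranking.shortlist_rel_none _ hVn]
      simp
    · rw [hi, Ranking.shortlist_rel_of_mem _ hVn rfl] at hj
      rw [hi, hj.1]
      exact p.refl _
  have h2 := hst (Function.update R a ((R a).shortlist U))
  set μ := deferredAcceptance C (Function.update R a ((R a).shortlist U)) with hμ
  have hir : ((R a).shortlist U).rel (μ a) none := by simpa using h2.1 a
  rw [Ranking.shortlist_rel_none _ hUn] at hir
  rcases hir with hir | hir
  · have h3 : Stable C (Function.update R a ((R a).shortlist {some i})) μ := by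
      refine h2.update hs hm ?_ fun j hj => ?_
      · rw [hir]
        exact Ranking.refl _ _
      · rw [hir, Ranking.shortlist_rel_none _ hVn] at hj
        rw [hir, Ranking.shortlist_rel_none _ hUn, hj.resolve_left (by simp)]
        exact Or.inr ((R a).refl _)
    have := (h1.eq_none_iff hs hm h3 a).2 hir
    simp [hi] at this
  · have h3 : Stable C (Function.update R a (R a)) μ := by
      refine h2.update hs hm ?_ fun j hj => ?_
      · exact (R a).trans _ _ _ hir ((R a).trans _ _ _ hbetter ((hst R).1 a))
      · rw [Ranking.shortlist_rel_of_mem _ hUn hir]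
        exact ⟨(R a).trans _ _ _ hj hir, hj⟩
    rw [Function.update_eq_self] at h3
    exact hcon ((R a).trans _ _ _ (h3.deferredAcceptance_rel hs a) hir)

/-- Deferred acceptance is the only stable and strategy-proof rule. -/
theorem eq_deferredAcceptance (hs : ∀ i, (C i).Substitutable) (hm : ∀ i, (C i).SizeMonotone)
    {φ : Problem A I → Matching A I} (hφ : ∀ R, Stable C R (φ R)) (hsp : StrategyProof φ) :
    φ = deferredAcceptance C := by
  funext R a
  by_contra hne
  have hbest := (hφ R).deferredAcceptance_rel hs a
  rcases hi : deferredAcceptance C R a with _ | i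
  · rw [hi] at hbest hne
    exact hne ((R a).antisymm _ _ ((hφ R).1 a) hbest)
  rw [hi] at hbest hne
  have hVn : (none : Option I) ∉ ({some i} : Set (Option I)) := by simp
  -- With only `i` acceptable, the deferred-acceptance outcome stays stable, so by rural hospitals
  -- `φ` must match the student, necessarily to `i`. Strategy-proofness then makes `φ R a` at least
  -- as good as `i`.
  have h1 : Stable C (Function.update R a ((R a).shortlist {some i}))
      (deferredAcceptance C R) := by
    have h0 : Stable C (Function.update R a (R a)) (deferredAcceptance C R) := by
      rw [Function.update_eq_self]
      exact stable_deferredAcceptance hs hm R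
    refine h0.update hs hm ?_ fun j hj => ?_
    · rw [hi, Ranking.shortlist_rel_none _ hVn]
      simp
    · rw [hi, Ranking.shortlist_rel_of_mem _ hVn rfl] at hj
      rw [hi, hj.1]
      exact (R a).refl _
  have h2 := hφ (Function.update R a ((R a).shortlist {some i}))
  have h3 : φ (Function.update R a ((R a).shortlist {some i})) a ≠ none := fun h => by
    have := (h1.eq_none_iff hs hm h2 a).2 h
    simp [hi] at this
  have h4 := h2.1 a
  rw [Function.update_self, Ranking.shortlist_rel_none _ hVn] at h4
  have h5 := hsp R a ((R a).shortlist {some i})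
  rw [h4.resolve_left h3] at h5
  exact hne ((R a).antisymm _ _ h5 hbest)

end Stability

/-! ### Matroid rank functions -/

/-- Monotone submodular functions with unit increase. -/
structure IsRankFunction {A : Type*} (r : Finset A → ℕ) : Prop where
  mono : ∀ {X Y : Finset A}, X ⊆ Y → r X ≤ r Y
  insert_le : ∀ (a : A) (X : Finset A), r (insert a X) ≤ r X + 1
  submod : ∀ X Y : Finset A, r (X ∪ Y) + r (X ∩ Y) ≤ r X + r Y

namespace IsRankFunction

variable {A : Type*} {r : Finset A → ℕ} (hr : IsRankFunction r)
include hr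

theorem insert_add_le (a : A) {X Y : Finset A} (h : X ⊆ Y) :
    r (insert a Y) + r X ≤ r (insert a X) + r Y := by
  have h1 := hr.submod (insert a X) Y
  rw [Finset.insert_union, Finset.union_eq_right.2 h] at h1
  have h2 : r X ≤ r (insert a X ∩ Y) :=
    hr.mono (Finset.subset_inter (Finset.subset_insert a X) h)
  omega

theorem union_le_add_card (S D : Finset A) : r (S ∪ D) ≤ r S + D.card := by
  induction D using Finset.induction_on with
  | empty => simp
  | insert a D ha ih =>
    rw [Finset.union_insert, Finset.card_insert_of_notMem ha]
    have := hr.insert_le a (S ∪ D)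
    omega

theorem add_card_le_of_subset {S V : Finset A} (h : S ⊆ V) : r V + S.card ≤ r S + V.card := by
  have h1 := hr.union_le_add_card S (V \ S)
  rw [Finset.union_sdiff_of_subset h] at h1
  have h2 := Finset.card_sdiff_add_card_eq_card h
  omega

theorem union_le {S D : Finset A} (h : ∀ y ∈ D, r (insert y S) ≤ r S) : r (S ∪ D) ≤ r S := by
  induction D using Finset.induction_on with
  | empty => simp
  | insert a D ha ih =>
    rw [Finset.union_insert]
    have h1 := ih fun y hy => h y (Finset.mem_insert_of_mem hy)
    have h2 := h a (Finset.mem_insert_self a D)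
    have h3 := hr.insert_add_le a (Finset.subset_union_left (s₁ := S) (s₂ := D))
    omega

/-- Elements of `D` act as coloops: by submodularity, deleting one still costs a unit of rank after
others are gone. -/
theorem sdiff_add_card_le {S D : Finset A} (hD : D ⊆ S) (h : ∀ y ∈ D, r (S.erase y) < r S) :
    r (S \ D) + D.card ≤ r S := by
  induction D using Finset.induction_on with
  | empty => simp
  | insert a D ha ih =>
    have h1 := ih ((Finset.subset_insert a D).trans hD)
      fun y hy => h y (Finset.mem_insert_of_mem hy)
    have h2 := h a (Finset.mem_insert_self a D)
    have haS : a ∈ S := hD (Finset.mem_insert_self a D)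
    have h3 := hr.insert_add_le a
      (Finset.erase_subset_erase a (Finset.sdiff_subset (s := S) (t := D)))
    rw [Finset.insert_erase haS, Finset.insert_erase (Finset.mem_sdiff.2 ⟨haS, ha⟩)] at h3
    rw [Finset.card_insert_of_notMem ha, Finset.sdiff_insert]
    omega

/-- The exchange property of the rank function on sets of equal size. -/
theorem exists_exchange {Z W : Finset A} (hcard : Z.card = W.card) {x : A} (hxZ : x ∈ Z)
    (hxW : x ∉ W) :
    ∃ y ∈ W \ Z, r Z + r W ≤ r (insert y (Z.erase x)) + r (insert x (W.erase y)) := by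
  by_contra! h
  have hD : (W \ Z).card = (Z \ W).card := (Finset.card_sdiff_comm hcard).symm
  have hxD : x ∈ Z \ W := Finset.mem_sdiff.2 ⟨hxZ, hxW⟩
  have hZ : insert x (Z.erase x) = Z := Finset.insert_erase hxZ
  have hα := hr.insert_le x (Z.erase x)
  rw [hZ] at hα
  have hα' : r (Z.erase x) ≤ r Z := hr.mono (Finset.erase_subset x Z)
  have hβ := hr.insert_le x W
  have hβ' : r W ≤ r (insert x W) := hr.mono (Finset.subset_insert x W)
  have hy : ∀ y ∈ W \ Z, r (Z.erase x) ≤ r (insert y (Z.erase x)) ∧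
      r (insert x W) ≤ r ((insert x W).erase y) + 1 ∧
      r ((insert x W).erase y) ≤ r (insert x W) ∧
      r (insert y (Z.erase x)) + r ((insert x W).erase y) < r Z + r W := by
    intro y hy
    have hyx : x ≠ y := by
      rintro rfl
      exact hxW (Finset.mem_sdiff.1 hy).1
    have h1 := hr.insert_le y ((insert x W).erase y)
    rw [Finset.insert_erase (Finset.mem_insert_of_mem (Finset.mem_sdiff.1 hy).1)] at h1
    refine ⟨hr.mono (Finset.subset_insert _ _), h1, hr.mono (Finset.erase_subset _ _), ?_⟩
    rw [Finset.erase_insert_of_ne hyx]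
    exact h y hy
  have hspan : ∀ E ⊆ W, (∀ y ∈ E \ Z, r (insert y (Z.erase x)) ≤ r (Z.erase x)) →
      r (Z.erase x ∪ E) ≤ r (Z.erase x) := by
    refine fun E hE hE' => hr.union_le fun y hyE => ?_
    by_cases hyZ : y ∈ Z
    · rw [Finset.insert_eq_of_mem]
      exact Finset.mem_erase.2 ⟨fun hyx => hxW (hyx ▸ hE hyE), hyZ⟩
    · exact hE' y (Finset.mem_sdiff.2 ⟨hyE, hyZ⟩)
  -- Here removing `x` lowers the rank of `Z` and adding `x` does not raise that of `W`. Every `y`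
  -- outside the span of `Z.erase x` is then a coloop of `insert x W`. Deleting the coloops `D`
  -- leaves `x` in the span of `W \ D`, hence of `Z.erase x`, a contradiction.
  by_cases hcase : r (Z.erase x) < r Z ∧ r (insert x W) ≤ r W
  · set D := (W \ Z).filter fun y => r ((insert x W).erase y) < r (insert x W) with hDdef
    have hDW : D ⊆ W := (Finset.filter_subset _ _).trans Finset.sdiff_subset
    have h1 := hr.sdiff_add_card_le (hDW.trans (Finset.subset_insert x W))
      fun y hyD => (Finset.mem_filter.1 hyD).2
    rw [Finset.insert_sdiff_of_notMem _ fun hxD => hxW (hDW hxD)] at h1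
    have h2 := hr.union_le_add_card (W \ D) D
    rw [Finset.sdiff_union_of_subset hDW] at h2
    have h3 := hspan (W \ D) Finset.sdiff_subset fun y hyD => by
      obtain ⟨hyD, hyZ⟩ := Finset.mem_sdiff.1 hyD
      obtain ⟨hyW, hyD⟩ := Finset.mem_sdiff.1 hyD
      have hyWZ := Finset.mem_sdiff.2 ⟨hyW, hyZ⟩
      have h4 : ¬ r ((insert x W).erase y) < r (insert x W) := fun h4 =>
        hyD (Finset.mem_filter.2 ⟨hyWZ, h4⟩)
      have := hy y hyWZ
      omega
    have h4 := hr.insert_add_le x (Finset.subset_union_right (s₁ := Z.erase x) (s₂ := W \ D))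
    have h5 : r Z ≤ r (insert x (Z.erase x ∪ W \ D)) := by
      refine hr.mono ?_
      rw [← Finset.insert_union, hZ]
      exact Finset.subset_union_left
    omega
  -- Otherwise all of `W \ Z` is both spanned by `Z.erase x` and made of coloops of `insert x W`.
  -- The first gives `r W ≤ r (Z.erase x)`; the second, with `Z \ W` and `W \ Z` of equal size,
  -- gives the opposite strict inequality.
  · have h1 := hspan W subset_rfl fun y hyD => by
      have := hy y hyD
      omega
    have h2 : r W ≤ r (Z.erase x ∪ W) := hr.mono Finset.subset_union_right
    have h3 := hr.sdiff_add_card_le (Finset.sdiff_subset.trans (Finset.subset_insert x W))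
      fun y (hyD : y ∈ W \ Z) => by
        have := hy y hyD
        omega
    rw [Finset.insert_sdiff_of_notMem _ fun hx => hxW (Finset.mem_sdiff.1 hx).1,
      Finset.sdiff_sdiff_self_left] at h3
    have h4 := hr.insert_add_le x (Finset.inter_subset_left (s₁ := W) (s₂ := Z))
    have h5 := hr.union_le_add_card (W ∩ Z) ((Z \ W).erase x)
    have h6 : r (Z.erase x) ≤ r (W ∩ Z ∪ (Z \ W).erase x) := by
      refine hr.mono fun z hz => ?_
      simp only [Finset.mem_erase, Finset.mem_union, Finset.mem_inter, Finset.mem_sdiff] at hz ⊢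
      tauto
    have h7 := Finset.card_erase_add_one hxD
    omega

end IsRankFunction

/-! ### The rank function of the transversal matroid -/

namespace Market

variable {A I T : Type*} (M : Market A I T)

theorem card_le_rank {i : I} {X Y : Finset A} (hY : Y ⊆ X) (h : M.Indep i Y) :
    Y.card ≤ M.rank i X :=
  Finset.le_sup (f := Finset.card) (Finset.mem_filter.2 ⟨Finset.mem_powerset.2 hY, h⟩)

theorem indep_empty (i : I) : M.Indep i ∅ :=
  ⟨fun a => absurd a.2 (Finset.notMem_empty _), fun a => absurd a.2 (Finset.notMem_empty _),
    fun a => absurd a.2 (Finset.notMem_empty _)⟩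

theorem exists_indep_card_eq_rank (i : I) (X : Finset A) :
    ∃ Y ⊆ X, M.Indep i Y ∧ Y.card = M.rank i X := by
  obtain ⟨Y, hY, h⟩ := Finset.exists_mem_eq_sup (X.powerset.filter fun Y => M.Indep i Y)
    ⟨∅, Finset.mem_filter.2 ⟨Finset.empty_mem_powerset X, M.indep_empty i⟩⟩ Finset.card
  rw [Finset.mem_filter, Finset.mem_powerset] at hY
  exact ⟨Y, hY.1, hY.2, h.symm⟩

theorem rank_mono (i : I) {X Y : Finset A} (h : X ⊆ Y) : M.rank i X ≤ M.rank i Y := by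
  obtain ⟨J, hJ, hJi, hJc⟩ := M.exists_indep_card_eq_rank i X
  rw [← hJc]
  exact M.card_le_rank (hJ.trans h) hJi

variable [Fintype T]

/-- The reserved seats for which some member of `Y` is eligible. -/
def eligibleSeats (i : I) (Y : Finset A) : Finset (M.Seat i) :=
  Finset.univ.filter fun s => ∃ a ∈ Y, s.1 ∈ M.traits a

theorem mem_eligibleSeats {i : I} {Y : Finset A} {s : M.Seat i} :
    s ∈ M.eligibleSeats i Y ↔ ∃ a ∈ Y, s.1 ∈ M.traits a := by
  simp [eligibleSeats]

theorem rank_le_eligibleSeats (i : I) (X Y : Finset A) :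
    M.rank i X ≤ (M.eligibleSeats i Y).card + (X \ Y).card := by
  obtain ⟨J, hJ, ⟨f, hf, hft⟩, hJc⟩ := M.exists_indep_card_eq_rank i X
  have h1 : (J ∩ Y).card ≤ (M.eligibleSeats i Y).card := by
    refine Finset.card_le_card_of_forall_subsingleton (fun a s => ∃ h : a ∈ J, f ⟨a, h⟩ = s)
      (fun a ha => ?_) fun s _ a ha b hb => ?_
    · obtain ⟨haJ, haY⟩ := Finset.mem_inter.1 ha
      exact ⟨f ⟨a, haJ⟩, M.mem_eligibleSeats.2 ⟨a, haY, hft ⟨a, haJ⟩⟩, haJ, rfl⟩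
    · obtain ⟨_, h1, h2⟩ := ha
      obtain ⟨_, h3, h4⟩ := hb
      exact congrArg Subtype.val (hf (h2.trans h4.symm))
  have h2 : (J \ Y).card ≤ (X \ Y).card := Finset.card_le_card (Finset.sdiff_subset_sdiff hJ le_rfl)
  have h3 := Finset.card_inter_add_card_sdiff J Y
  omega

/-- The deficiency version of Hall's theorem. -/
theorem exists_eligibleSeats_le_rank (i : I) (X : Finset A) :
    ∃ Y ⊆ X, (M.eligibleSeats i Y).card + (X \ Y).card ≤ M.rank i X := by
  obtain ⟨Y, hYX, hmin⟩ := Finset.exists_min_image X.powerset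
    (fun Y => (M.eligibleSeats i Y).card + (X \ Y).card) ⟨∅, Finset.empty_mem_powerset X⟩
  refine ⟨Y, Finset.mem_powerset.1 hYX, ?_⟩
  set d := (M.eligibleSeats i Y).card + (X \ Y).card with hd
  have hdX : d ≤ X.card := by
    have := hmin ∅ (Finset.empty_mem_powerset X)
    simpa [eligibleSeats] using this
  -- Hall's theorem is applied after adding `X.card - d` dummy seats open to everyone; minimality of
  -- `d` is Hall's condition. At most that many students get dummy seats, so at least `d` get real
  -- ones.
  obtain ⟨g, hg, hgt⟩ := (Finset.all_card_le_biUnion_card_iff_exists_injective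
    fun a : {a // a ∈ X} => (M.eligibleSeats i {a.1}).disjSum
      (Finset.univ : Finset (Fin (X.card - d)))).1 fun s => by
    rcases s.eq_empty_or_nonempty with rfl | ⟨a₀, ha₀⟩
    · simp
    have hsX : s.map (Function.Embedding.subtype _) ⊆ X := fun a ha => by
      obtain ⟨b, _, rfl⟩ := Finset.mem_map.1 ha
      exact b.2
    have h1 := hmin _ (Finset.mem_powerset.2 hsX)
    have h2 := Finset.card_sdiff_add_card_eq_card hsX
    have h3 : (s.biUnion fun a : {a // a ∈ X} => (M.eligibleSeats i {a.1}).disjSum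
        (Finset.univ : Finset (Fin (X.card - d)))) =
        (M.eligibleSeats i (s.map (Function.Embedding.subtype _))).disjSum Finset.univ := by
      ext (z | z)
      · simp [mem_eligibleSeats]
      · simpa using ⟨a₀.1, a₀.2, ha₀⟩
    rw [h3, Finset.card_disjSum, Finset.card_univ, Fintype.card_fin]
    rw [Finset.card_map] at h2
    omega
  set J := X.filter fun a => ∃ (h : a ∈ X) (s : M.Seat i), g ⟨a, h⟩ = Sum.inl s with hJ
  have hJi : M.Indep i J := by
    have hex : ∀ a : {a // a ∈ J}, ∃ s : M.Seat i,
        g ⟨a.1, Finset.filter_subset _ _ a.2⟩ = Sum.inl s :=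
      fun a => (Finset.mem_filter.1 a.2).2.choose_spec
    choose f hf using hex
    refine ⟨f, fun a b hab => ?_, fun a => ?_⟩
    · have := hg ((hf a).trans ((congrArg Sum.inl hab).trans (hf b).symm))
      exact Subtype.ext (by simpa using this)
    · have := hgt ⟨a.1, Finset.filter_subset _ _ a.2⟩
      rw [hf a, Finset.inl_mem_disjSum, mem_eligibleSeats] at this
      simpa using this
  have h1 : J.card ≤ M.rank i X := M.card_le_rank (Finset.filter_subset _ X) hJi
  have h2 : (X \ J).card ≤ (Finset.univ : Finset (Fin (X.card - d))).card := by
    refine Finset.card_le_card_of_forall_subsingleton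
      (fun a k => ∃ h : a ∈ X, g ⟨a, h⟩ = Sum.inr k) (fun a ha => ?_) fun k _ a ha b hb => ?_
    · obtain ⟨haX, haJ⟩ := Finset.mem_sdiff.1 ha
      rcases hga : g ⟨a, haX⟩ with s | k
      · exact absurd (Finset.mem_filter.2 ⟨haX, haX, s, hga⟩) haJ
      · exact ⟨k, Finset.mem_univ k, haX, hga⟩
    · obtain ⟨_, h1, h2⟩ := ha
      obtain ⟨_, h3, h4⟩ := hb
      exact congrArg Subtype.val (hg (h2.trans h4.symm))
  rw [Finset.card_univ, Fintype.card_fin] at h2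
  have h3 : (X \ J).card + J.card = X.card :=
    Finset.card_sdiff_add_card_eq_card (Finset.filter_subset _ X)
  omega

/-- The rank is the minimum over `Y ⊆ X` of eligible seats of `Y` plus `(X \ Y).card`. Submodularity
follows by combining minimizers through union and intersection, since eligible seats form a coverage
function. -/
theorem isRankFunction_rank (i : I) : IsRankFunction (M.rank i) where
  mono := M.rank_mono i
  insert_le a X := by
    obtain ⟨Y, hY, h⟩ := M.exists_eligibleSeats_le_rank i X
    have h1 := M.rank_le_eligibleSeats i (insert a X) Y
    have h2 := Finset.card_sdiff_add_card_eq_card hY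
    have h3 := Finset.card_sdiff_add_card_eq_card (hY.trans (Finset.subset_insert a X))
    have h4 := Finset.card_insert_le a X
    omega
  submod X X' := by
    obtain ⟨Y, hY, h⟩ := M.exists_eligibleSeats_le_rank i X
    obtain ⟨Y', hY', h'⟩ := M.exists_eligibleSeats_le_rank i X'
    have hu := M.rank_le_eligibleSeats i (X ∪ X') (Y ∪ Y')
    have hi := M.rank_le_eligibleSeats i (X ∩ X') (Y ∩ Y')
    have e1 := Finset.card_sdiff_add_card_eq_card hY
    have e2 := Finset.card_sdiff_add_card_eq_card hY'
    have e3 := Finset.card_sdiff_add_card_eq_card (Finset.union_subset_union hY hY')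
    have e4 := Finset.card_sdiff_add_card_eq_card (Finset.inter_subset_inter hY hY')
    have e5 := Finset.card_union_add_card_inter X X'
    have e6 := Finset.card_union_add_card_inter Y Y'
    have e7 := Finset.card_union_add_card_inter (M.eligibleSeats i Y) (M.eligibleSeats i Y')
    have e8 : (M.eligibleSeats i (Y ∪ Y')).card ≤
        (M.eligibleSeats i Y ∪ M.eligibleSeats i Y').card := by
      refine Finset.card_le_card fun s hs => ?_
      simp only [Finset.mem_union, mem_eligibleSeats] at hs ⊢
      grind
    have e9 : (M.eligibleSeats i (Y ∩ Y')).card ≤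
        (M.eligibleSeats i Y ∩ M.eligibleSeats i Y').card := by
      refine Finset.card_le_card fun s hs => ?_
      simp only [Finset.mem_inter, mem_eligibleSeats] at hs ⊢
      grind
    omega

theorem rank_le_sum_reserve (i : I) (X : Finset A) : M.rank i X ≤ ∑ t, M.reserve i t := by
  have h1 := M.rank_le_eligibleSeats i X X
  have h2 := Finset.card_le_univ (M.eligibleSeats i X)
  simp only [Fintype.card_sigma, Fintype.card_fin, Finset.sdiff_self, Finset.card_empty] at h1 h2
  omega

end Market

namespace Market

variable {A I T : Type*} (M : Market A I T)

/-! ### Locally optimal choices -/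

/-- `Z` is a choice from `X` that respects the returning students and the capacity, and that no
exchange of a single student improves in terms of reserve utilization and priority. -/
structure IsLocallyOptimal (i : I) (X Z : Finset A) : Prop where
  subset : Z ⊆ X
  returning_subset : X ∩ M.returning i ⊆ Z
  card_le : Z.card ≤ M.capacity i
  card_eq : ∀ a ∈ X \ Z, Z.card = M.capacity i
  rank_le : ∀ a ∈ X \ Z, ∀ b ∈ Z \ M.returning i,
    M.rank i ((Z \ {b}) ∪ {a}) ≤ M.rank i Z
  rank_lt : ∀ a ∈ X \ Z, ∀ b ∈ Z \ M.returning i, (M.priority i).strict a b →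
    M.rank i ((Z \ {b}) ∪ {a}) < M.rank i Z

theorem sdiff_union_singleton (Z : Finset A) (a b : A) :
    (Z \ {b}) ∪ {a} = insert a (Z.erase b) := by
  rw [Finset.sdiff_singleton_eq_erase, Finset.union_comm, Finset.insert_eq]

section Axioms

variable [Fintype A]

theorem mem_demand_sdiff_at {R : Problem A I} {μ : Matching A I} {i : I} {a : A} :
    a ∈ demand R μ i \ μ.at i ↔ (R a).strict (some i) (μ a) := by
  rw [Finset.mem_sdiff, mem_demand, Matching.mem_at, Ranking.strict, ne_comm, Ne, eq_comm]

/-- Local optimality of the choices from the demands restates the axioms. -/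
theorem axioms_iff_isLocallyOptimal (R : Problem A I) (μ : Matching A I) :
    (M.GuaranteedEnrollment R μ ∧ M.MaximalUtilization R μ ∧
      M.NoJustifiedEnvyUnderReserves R μ ∧ M.NonWasteful R μ) ↔
    ∀ i, M.IsLocallyOptimal i (demand R μ i) (μ.at i) := by
  constructor
  · rintro ⟨hge, hmu, hnje, hnw⟩ i
    refine ⟨at_subset_demand R μ i, fun a ha => ?_, (hnw i).1, fun a ha => ?_,
      fun a ha => ?_, fun a ha => ?_⟩
    · obtain ⟨had, har⟩ := Finset.mem_inter.1 ha
      by_contra hat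
      have h := hge i a har hat
      exact h.2 ((R a).antisymm _ _ h.1 (mem_demand.1 had))
    · exact (hnw i).2 a (mem_demand_sdiff_at.1 ha)
    · have h := mem_demand_sdiff_at.1 ha
      exact (hmu i a (Finset.mem_sdiff.1 ha).2 h).2 ((hnw i).2 a h)
    · exact hnje i a (Finset.mem_sdiff.1 ha).2 (mem_demand_sdiff_at.1 ha)
  · intro h
    refine ⟨fun i a har hat => ?_, fun i a _ hs => ⟨fun hlt => ?_, fun _ => ?_⟩,
      fun i a _ hs => ?_, fun i => ⟨(h i).card_le, fun a hs => ?_⟩⟩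
    · have hnd : a ∉ demand R μ i := fun hd =>
        hat ((h i).returning_subset (Finset.mem_inter.2 ⟨hd, har⟩))
      rw [mem_demand] at hnd
      exact ⟨(R a).rel_of_not_rel hnd, fun he => hat (Matching.mem_at.2 he)⟩
    -- The clause on unfilled schools is vacuous: a school with unmet demand is full.
    · exact absurd ((h i).card_eq a (mem_demand_sdiff_at.2 hs)) hlt.ne
    · exact (h i).rank_le a (mem_demand_sdiff_at.2 hs)
    · exact (h i).rank_lt a (mem_demand_sdiff_at.2 hs)
    · exact (h i).card_eq a (mem_demand_sdiff_at.2 hs)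

end Axioms

/-- If `x ∈ W ∩ X` were missing from `Z`, both sets would have capacity size and the exchange
inequality would supply `y ∈ Z \ W` whose swap with `x` does not lower the total rank. Neither swap
may raise a rank, and the one that brings in the student of higher priority must lower it, a
contradiction. -/
theorem IsLocallyOptimal.inter_subset [Fintype T] {M : Market A I T} {i : I} {X Y Z W : Finset A}
    (hXY : X ⊆ Y) (hZ : M.IsLocallyOptimal i X Z) (hW : M.IsLocallyOptimal i Y W) :
    W ∩ X ⊆ Z := by
  intro x hx
  obtain ⟨hxW, hxX⟩ := Finset.mem_inter.1 hx
  by_contra hxZ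
  have hxXZ : x ∈ X \ Z := Finset.mem_sdiff.2 ⟨hxX, hxZ⟩
  have hZc := hZ.card_eq x hxXZ
  have hcard : W.card = Z.card := by
    by_cases hYW : Y ⊆ W
    · have h1 : insert x Z ⊆ W := Finset.insert_subset hxW ((hZ.subset.trans hXY).trans hYW)
      have h2 := Finset.card_le_card h1
      rw [Finset.card_insert_of_notMem hxZ] at h2
      have := hW.card_le
      omega
    · obtain ⟨a, haY, haW⟩ := Finset.not_subset.1 hYW
      rw [hZc, hW.card_eq a (Finset.mem_sdiff.2 ⟨haY, haW⟩)]
  obtain ⟨y, hy, hex⟩ := (M.isRankFunction_rank i).exists_exchange hcard hxW hxZ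
  obtain ⟨hyZ, hyW⟩ := Finset.mem_sdiff.1 hy
  have hyX := hZ.subset hyZ
  have hyYW : y ∈ Y \ W := Finset.mem_sdiff.2 ⟨hXY hyX, hyW⟩
  have hxr : x ∈ W \ M.returning i := Finset.mem_sdiff.2
    ⟨hxW, fun h => hxZ (hZ.returning_subset (Finset.mem_inter.2 ⟨hxX, h⟩))⟩
  have hyr : y ∈ Z \ M.returning i := Finset.mem_sdiff.2
    ⟨hyZ, fun h => hyW (hW.returning_subset (Finset.mem_inter.2 ⟨hXY hyX, h⟩))⟩
  have hxy : x ≠ y := fun h => hxZ (h ▸ hyZ)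
  have h1 := hW.rank_le y hyYW x hxr
  have h2 := hZ.rank_le x hxXZ y hyr
  have h3 := hW.rank_lt y hyYW x hxr
  have h4 := hZ.rank_lt x hxXZ y hyr
  rw [sdiff_union_singleton] at h1 h2 h3 h4
  rcases (M.priority i).total x y with h | h
  · have := h4 ⟨h, hxy⟩
    omega
  · have := h3 ⟨h, hxy.symm⟩
    omega

theorem IsLocallyOptimal.unique [Fintype T] {M : Market A I T} {i : I} {X Z W : Finset A}
    (hZ : M.IsLocallyOptimal i X Z) (hW : M.IsLocallyOptimal i X W) : Z = W := by
  refine Finset.Subset.antisymm ?_ ?_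
  · have := hW.inter_subset subset_rfl hZ
    rwa [Finset.inter_eq_left.2 hZ.subset] at this
  · have := hZ.inter_subset subset_rfl hW
    rwa [Finset.inter_eq_left.2 hW.subset] at this

/-! ### The guaranteed-enrollment choice rule is locally optimal -/

/-- This justifies the fixed iteration counts: either the process has stalled or its measure, rank
or size, has reached the count, which bounds it. -/
theorem iterate_eq_or_le {S : Type*} {f : S → S} {m : S → ℕ} (h : ∀ Y, f Y = Y ∨ m Y < m (f Y))
    (n : ℕ) (Y : S) : f (f^[n] Y) = f^[n] Y ∨ n ≤ m (f^[n] Y) := by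
  induction n with
  | zero => exact Or.inr (Nat.zero_le _)
  | succ n ih =>
    rw [Function.iterate_succ_apply']
    rcases ih with ih | ih
    · exact Or.inl (by rw [ih, ih])
    · rcases h (f^[n] Y) with h | h
      · exact Or.inl (by rw [h, h])
      · exact Or.inr (by omega)

/-- What the sets chosen during the reserve steps have in common. -/
structure ReserveInvariant (i : I) (X Y : Finset A) : Prop where
  returning_subset : X ∩ M.returning i ⊆ Y
  subset : Y ⊆ X
  card_le : Y.card ≤ M.capacity i
  rank_eq : M.rank i Y + (X ∩ M.returning i).card = M.rank i (X ∩ M.returning i) + Y.card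
  span : ∀ y ∈ Y \ M.returning i, ∀ z ∈ X \ Y, (M.priority i).strict z y →
    M.rank i (insert z (Y.erase y)) ≤ M.rank i (Y.erase y)

theorem reserveInvariant_returning (i : I) (X : Finset A) :
    M.ReserveInvariant i X (X ∩ M.returning i) where
  returning_subset := subset_rfl
  subset := Finset.inter_subset_left
  card_le := (Finset.card_le_card Finset.inter_subset_right).trans (M.card_returning_le i)
  rank_eq := rfl
  span _ hy := absurd (Finset.mem_inter.1 (Finset.mem_sdiff.1 hy).1).2 (Finset.mem_sdiff.1 hy).2

/-- For the newly chosen student, `span` holds because any higher-priority applicant raising the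
rank would have been chosen instead. For earlier ones it persists by diminishing marginal rank. -/
theorem ReserveInvariant.reserveStep [Fintype T] {M : Market A I T} {i : I} {X Y : Finset A}
    (h : M.ReserveInvariant i X Y) : M.ReserveInvariant i X (M.reserveStep i X Y) := by
  have hsub := M.reserveStep_subset i h.subset
  unfold Market.reserveStep at hsub ⊢
  split_ifs at hsub ⊢ with hc
  · have hmem := (M.priority i).best_mem _ hc.2
    have hbest := (M.priority i).best_rel _ hc.2
    set b := (M.priority i).best _ hc.2
    obtain ⟨hb, hbr⟩ := Finset.mem_filter.1 hmem
    obtain ⟨hbX, hbY⟩ := Finset.mem_sdiff.1 hb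
    have hcard := Finset.card_insert_of_notMem hbY
    have heq := h.rank_eq
    refine ⟨h.returning_subset.trans (Finset.subset_insert _ _), hsub, by omega, by omega, ?_⟩
    intro y hy z hz hzy
    obtain ⟨hy, hyr⟩ := Finset.mem_sdiff.1 hy
    obtain ⟨hzX, hzY⟩ := Finset.mem_sdiff.1 hz
    have hzY' : z ∉ Y := fun h => hzY (Finset.mem_insert_of_mem h)
    have hzXY := Finset.mem_sdiff.2 ⟨hzX, hzY'⟩
    by_cases hyb : y = b
    · rw [hyb, Finset.erase_insert hbY]
      have h1 := (M.isRankFunction_rank i).insert_le z Y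
      by_contra hlt
      have h2 := hbest z (Finset.mem_filter.2 ⟨hzXY, by omega⟩)
      rw [hyb] at hzy
      exact hzy.2 ((M.priority i).antisymm _ _ hzy.1 h2)
    · have hyY := Finset.mem_of_mem_insert_of_ne hy hyb
      have h1 := h.span y (Finset.mem_sdiff.2 ⟨hyY, hyr⟩) z hzXY hzy
      have h2 := (M.isRankFunction_rank i).insert_add_le z
        (Finset.erase_subset_erase y (Finset.subset_insert b Y))
      omega
  · exact h

theorem reserveStep_eq_or_lt (i : I) (X Y : Finset A) :
    M.reserveStep i X Y = Y ∨ M.rank i Y < M.rank i (M.reserveStep i X Y) := by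
  unfold reserveStep
  split_ifs with hc
  · have := (Finset.mem_filter.1 ((M.priority i).best_mem _ hc.2)).2
    exact Or.inr (by omega)
  · exact Or.inl rfl

theorem fillStep_eq_or_lt (i : I) (X Y : Finset A) :
    M.fillStep i X Y = Y ∨ Y.card < (M.fillStep i X Y).card := by
  unfold fillStep
  split_ifs with hc
  · have := (Finset.mem_sdiff.1 ((M.priority i).best_mem _ hc.2)).2
    rw [Finset.card_insert_of_notMem this]
    exact Or.inr (Nat.lt_succ_self _)
  · exact Or.inl rfl

/-- The reserve steps end when the capacity is reached or the reserve utilization is maximal. -/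
theorem capacity_le_or_rank_le [Fintype T] {i : I} {X Y : Finset A} (hY : Y ⊆ X)
    (h : M.reserveStep i X Y = Y ∨ ∑ t, M.reserve i t ≤ M.rank i Y) :
    M.capacity i ≤ Y.card ∨ M.rank i X ≤ M.rank i Y := by
  rcases h with h | h
  · by_cases hc : Y.card < M.capacity i
    · refine Or.inr ?_
      have h1 : ∀ z ∈ X, M.rank i (insert z Y) ≤ M.rank i Y := fun z hz => by
        by_contra hlt
        have h2 := (M.isRankFunction_rank i).insert_le z Y
        have hzY : z ∉ Y := fun hzY => hlt (by rw [Finset.insert_eq_of_mem hzY])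
        have hne : ((X \ Y).filter fun a => M.rank i (insert a Y) = M.rank i Y + 1).Nonempty :=
          ⟨z, Finset.mem_filter.2 ⟨Finset.mem_sdiff.2 ⟨hz, hzY⟩, by omega⟩⟩
        rw [reserveStep, dif_pos ⟨hc, hne⟩] at h
        have h3 := (Finset.mem_filter.1 ((M.priority i).best_mem _ hne)).1
        exact (Finset.mem_sdiff.1 h3).2 (Finset.insert_eq_self.1 h)
      have h2 := (M.isRankFunction_rank i).union_le h1
      rwa [Finset.union_eq_right.2 hY] at h2
    · exact Or.inl (not_lt.1 hc)
  · exact Or.inr ((M.rank_le_sum_reserve i X).trans h)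

/-- What the sets chosen during the fill steps, which start from `B`, have in common. -/
structure FillInvariant (i : I) (X B Y : Finset A) : Prop where
  base_subset : B ⊆ Y
  subset : Y ⊆ X
  card_le : Y.card ≤ M.capacity i
  rel : ∀ y ∈ Y \ B, ∀ z ∈ X \ Y, (M.priority i).rel y z

theorem FillInvariant.fillStep {M : Market A I T} {i : I} {X B Y : Finset A}
    (h : M.FillInvariant i X B Y) : M.FillInvariant i X B (M.fillStep i X Y) := by
  have hsub := M.fillStep_subset i h.subset
  unfold Market.fillStep at hsub ⊢
  split_ifs at hsub ⊢ with hc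
  · have hmem := (M.priority i).best_mem _ hc.2
    have hbest := (M.priority i).best_rel _ hc.2
    set b := (M.priority i).best _ hc.2
    have hcard := Finset.card_insert_of_notMem (Finset.mem_sdiff.1 hmem).2
    refine ⟨h.base_subset.trans (Finset.subset_insert _ _), hsub, by omega, ?_⟩
    intro y hy z hz
    obtain ⟨hy, hyB⟩ := Finset.mem_sdiff.1 hy
    obtain ⟨hzX, hzY⟩ := Finset.mem_sdiff.1 hz
    have hzXY := Finset.mem_sdiff.2 ⟨hzX, fun h => hzY (Finset.mem_insert_of_mem h)⟩
    rcases Finset.mem_insert.1 hy with rfl | hy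
    · exact hbest z hzXY
    · exact h.rel y (Finset.mem_sdiff.2 ⟨hy, hyB⟩) z hzXY
  · exact h

theorem capacity_le_or_subset {i : I} {X Y : Finset A} (hY : Y ⊆ X)
    (h : M.fillStep i X Y = Y ∨ X.card ≤ Y.card) : M.capacity i ≤ Y.card ∨ X ⊆ Y := by
  rcases h with h | h
  · by_contra! hcon
    have hne : (X \ Y).Nonempty := Finset.sdiff_nonempty.2 hcon.2
    rw [fillStep, dif_pos ⟨hcon.1, hne⟩] at h
    exact (Finset.mem_sdiff.1 ((M.priority i).best_mem _ hne)).2 (Finset.insert_eq_self.1 h)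
  · exact Or.inr (Finset.eq_of_subset_of_card_le hY h).ge

theorem FillInvariant.isLocallyOptimal [Fintype T] {M : Market A I T} {i : I} {X B Z : Finset A}
    (hB : M.ReserveInvariant i X B) (hB' : M.capacity i ≤ B.card ∨ M.rank i X ≤ M.rank i B)
    (hZ : M.FillInvariant i X B Z) (hZ' : M.capacity i ≤ Z.card ∨ X ⊆ Z) :
    M.IsLocallyOptimal i X Z where
  subset := hZ.subset
  returning_subset := hB.returning_subset.trans hZ.base_subset
  card_le := hZ.card_le
  card_eq a ha := by
    obtain ⟨haX, haZ⟩ := Finset.mem_sdiff.1 ha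
    exact le_antisymm hZ.card_le (hZ'.resolve_right fun h => haZ (h haX))
  rank_le a ha b hb := by
    have hr := M.isRankFunction_rank i
    obtain ⟨haX, haZ⟩ := Finset.mem_sdiff.1 ha
    obtain ⟨hbZ, hbr⟩ := Finset.mem_sdiff.1 hb
    rw [sdiff_union_singleton]
    rcases hB' with hB' | hB'
    · obtain rfl : B = Z :=
        Finset.eq_of_subset_of_card_le hZ.base_subset (hZ.card_le.trans hB')
      -- If the reserve steps fill the school, `B` has the largest rank possible for its size among
      -- sets containing the returning applicants.
      have h1 := hr.add_card_le_of_subset (S := X ∩ M.returning i) (V := insert a (B.erase b))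
        (fun c hc => Finset.mem_insert_of_mem (Finset.mem_erase.2
          ⟨fun h => hbr (h ▸ (Finset.mem_inter.1 hc).2), hB.returning_subset hc⟩))
      rw [Finset.card_insert_of_notMem fun h => haZ (Finset.mem_of_mem_erase h),
        Finset.card_erase_add_one hbZ] at h1
      have := hB.rank_eq
      omega
    · exact (hr.mono (Finset.insert_subset haX ((Finset.erase_subset b Z).trans hZ.subset))).trans
        (hB'.trans (hr.mono hZ.base_subset))
  rank_lt a ha b hb hab := by
    have hr := M.isRankFunction_rank i
    obtain ⟨haX, haZ⟩ := Finset.mem_sdiff.1 ha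
    obtain ⟨hbZ, hbr⟩ := Finset.mem_sdiff.1 hb
    rw [sdiff_union_singleton]
    have hbB : b ∈ B := by
      by_contra hbB
      exact hab.2 ((M.priority i).antisymm _ _ hab.1
        (hZ.rel b (Finset.mem_sdiff.2 ⟨hbZ, hbB⟩) a ha))
    have h1 := hr.add_card_le_of_subset (S := X ∩ M.returning i) (V := B.erase b)
      (fun c hc => Finset.mem_erase.2
        ⟨fun h => hbr (h ▸ (Finset.mem_inter.1 hc).2), hB.returning_subset hc⟩)
    have h2 := hB.rank_eq
    have h3 := Finset.card_erase_add_one hbB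
    -- Students added in the fill steps rank weakly above `a`, hence above `b`. So `B.erase b` spans
    -- them and `a`, and the swapped set has rank below that of `B`.
    have h4 : ∀ c ∈ insert a (Z \ B), M.rank i (insert c (B.erase b)) ≤ M.rank i (B.erase b) := by
      intro c hc
      have hbBr := Finset.mem_sdiff.2 ⟨hbB, hbr⟩
      rcases Finset.mem_insert.1 hc with rfl | hc
      · exact hB.span b hbBr c
          (Finset.mem_sdiff.2 ⟨haX, fun h => haZ (hZ.base_subset h)⟩) hab
      · obtain ⟨hcZ, hcB⟩ := Finset.mem_sdiff.1 hc
        refine hB.span b hbBr c (Finset.mem_sdiff.2 ⟨hZ.subset hcZ, hcB⟩) ⟨?_, ?_⟩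
        · exact (M.priority i).trans _ _ _ (hZ.rel c hc a ha) hab.1
        · exact fun h => hcB (h ▸ hbB)
    have h5 := hr.union_le h4
    have h6 : M.rank i (insert a (Z.erase b)) ≤ M.rank i (B.erase b ∪ insert a (Z \ B)) := by
      refine hr.mono fun c hc => ?_
      simp only [Finset.mem_insert, Finset.mem_erase, Finset.mem_union, Finset.mem_sdiff] at hc ⊢
      tauto
    have h7 := hr.mono hZ.base_subset
    omega

/-! ### The guaranteed-enrollment rule and stability -/

variable [Fintype T]

theorem isLocallyOptimal_geChoice (i : I) (X : Finset A) :
    M.IsLocallyOptimal i X ((M.geChoice i).choice X) := by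
  set B := (M.reserveStep i X)^[∑ t, M.reserve i t] (X ∩ M.returning i) with hBdef
  have hB : M.ReserveInvariant i X B :=
    Function.Iterate.rec (M.ReserveInvariant i X) (M.reserveInvariant_returning i X)
      (fun _ h => h.reserveStep) _
  have hZ : M.FillInvariant i X B ((M.fillStep i X)^[X.card] B) :=
    Function.Iterate.rec (M.FillInvariant i X B)
      ⟨subset_rfl, hB.subset, hB.card_le, fun y hy => by simp at hy⟩ (fun _ h => h.fillStep) _
  exact hZ.isLocallyOptimal hB
    (M.capacity_le_or_rank_le hB.subset (iterate_eq_or_le (M.reserveStep_eq_or_lt i X) _ _))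
    (M.capacity_le_or_subset hZ.subset (iterate_eq_or_le (M.fillStep_eq_or_lt i X) _ _))

theorem substitutable_geChoice (i : I) : (M.geChoice i).Substitutable := fun X Y h =>
  (M.isLocallyOptimal_geChoice i X).inter_subset h (M.isLocallyOptimal_geChoice i Y)

theorem sizeMonotone_geChoice (i : I) : (M.geChoice i).SizeMonotone := fun X Y h => by
  have hX := M.isLocallyOptimal_geChoice i X
  have hY := M.isLocallyOptimal_geChoice i Y
  by_cases hYY : Y ⊆ (M.geChoice i).choice Y
  · exact Finset.card_le_card ((hX.subset.trans h).trans hYY)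
  · obtain ⟨a, haY, ha⟩ := Finset.not_subset.1 hYY
    rw [hY.card_eq a (Finset.mem_sdiff.2 ⟨haY, ha⟩)]
    exact hX.card_le

theorem axioms_iff_stable [Fintype A] (R : Problem A I) (μ : Matching A I) :
    (M.GuaranteedEnrollment R μ ∧ M.MaximalUtilization R μ ∧
      M.NoJustifiedEnvyUnderReserves R μ ∧ M.NonWasteful R μ ∧ IndividuallyRational R μ) ↔
    Stable M.geChoice R μ := by
  have h : (∀ i, M.IsLocallyOptimal i (demand R μ i) (μ.at i)) ↔
      ∀ i, (M.geChoice i).choice (demand R μ i) = μ.at i :=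
    forall_congr' fun i =>
      ⟨(M.isLocallyOptimal_geChoice i _).unique, fun h => h ▸ M.isLocallyOptimal_geChoice i _⟩
  rw [Stable, ← h, ← axioms_iff_isLocallyOptimal]
  tauto

end Market

end SchoolChoice

end

theorem mainTheorem3 {A I T : Type*} [Fintype A] [Fintype I] [Fintype T]
    (M : Market A I T) (φ : Problem A I → Matching A I) :
    ((∀ R, M.GuaranteedEnrollment R (φ R)) ∧
      (∀ R, M.MaximalUtilization R (φ R)) ∧
      (∀ R, M.NoJustifiedEnvyUnderReserves R (φ R)) ∧
      (∀ R, M.NonWasteful R (φ R)) ∧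
      (∀ R, IndividuallyRational R (φ R)) ∧
      StrategyProof φ) ↔
    φ = deferredAcceptance M.geChoice := by
  have hs := M.substitutable_geChoice
  have hm := M.sizeMonotone_geChoice
  constructor
  · rintro ⟨h1, h2, h3, h4, h5, hsp⟩
    exact eq_deferredAcceptance hs hm
      (fun R => (M.axioms_iff_stable R (φ R)).1 ⟨h1 R, h2 R, h3 R, h4 R, h5 R⟩) hsp
  · rintro rfl
    have h := fun R => (M.axioms_iff_stable R _).2 (stable_deferredAcceptance hs hm R)
    exact ⟨fun R => (h R).1, fun R => (h R).2.1, fun R => (h R).2.2.1, fun R => (h R).2.2.2.1,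
      fun R => (h R).2.2.2.2, strategyProof_deferredAcceptance hs hm⟩
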